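/- Let $Y$ be a real Banach space; "subspace" means closed linear subspace. A Banach space $Z$ is *octahedral* if for every $\varepsilon>0$ and every finite subset $A$ of its unit sphere $S_Z$ there is $z\in S_Z$ with $\|a-z\|\ge 2-\varepsilon$ for all $a\in A$. A subspace $X$ of $Y$ is an *almost isometric ideal* (ai-ideal) in $Y$ if for every $\varepsilon>0$ and every finite-dimensional subspace $E$ of $Y$ there is a linear operator $T:E\to X$ with $Te=e$ for all $e\in E\cap X$ and $(1-\varepsilon)\|e\|\le\|Te\|\le(1+\varepsilon)\|e\|$ for all $e\in E$. A Banach space *contains a copy of* $\ell_1$ if it has a subspace linearly homeomorphic to $\ell_1$. Then the following statements are equivalent: (a) $Y$ is octahedral. (b) Every separable ai-ideal in $Y$ is octahedral. (c) Every subspace $X$ of $Y$ for which the quotient $Y/X$ does not contain a copy of $\ell_1$ is octahedral. (d) Every subspace of finite codimension in $Y$ is octahedral. -/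

import Mathlib

/-- A normed space `Y` is octahedral if for every `ε > 0` and every finite subset `A` of its unit
sphere there is a `y` in the unit sphere such that `‖a - y‖ ≥ 2 - ε` for all `a ∈ A`. -/
def IsOctahedral (Y : Type*) [NormedAddCommGroup Y] : Prop :=
  ∀ ε : ℝ, 0 < ε → ∀ A : Finset Y, (∀ a ∈ A, ‖a‖ = 1) →
    ∃ y : Y, ‖y‖ = 1 ∧ ∀ a ∈ A, 2 - ε ≤ ‖a - y‖

/-- A subspace `X` of `Y` is an almost isometric ideal (ai-ideal) in `Y` if for every `ε > 0` and
every finite-dimensional subspace `E` of `Y` there is a linear operator `T : E → X` which is the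
identity on `E ∩ X` and satisfies `(1 - ε) ‖e‖ ≤ ‖T e‖ ≤ (1 + ε) ‖e‖` on `E`. -/
def IsAIIdeal {Y : Type*} [NormedAddCommGroup Y] [NormedSpace ℝ Y] (X : Submodule ℝ Y) : Prop :=
  ∀ ε : ℝ, 0 < ε → ∀ E : Submodule ℝ Y, FiniteDimensional ℝ E →
    ∃ T : E →ₗ[ℝ] X,
      (∀ e : E, (e : Y) ∈ X → (T e : Y) = (e : Y)) ∧
      ∀ e : E, (1 - ε) * ‖e‖ ≤ ‖T e‖ ∧ ‖T e‖ ≤ (1 + ε) * ‖e‖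

/-- `Z` contains a copy of `ℓ₁` if some linear subspace of `Z` is linearly homeomorphic to the
Banach space `ℓ₁` of absolutely summable real sequences. -/
def ContainsCopyOfL1 (Z : Type*) [SeminormedAddCommGroup Z] [NormedSpace ℝ Z] : Prop :=
  ∃ W : Submodule ℝ Z, Nonempty (lp (fun _ : ℕ => ℝ) 1 ≃L[ℝ] W)

/-! ### Vectors and sequences almost `ℓ₁`-orthogonal to a finite set. -/

section Octahedral

variable {Y : Type*} [NormedAddCommGroup Y] [NormedSpace ℝ Y]

/-! (a) ⇒ (c): compactness of the unit sphere of a finite-dimensional subspace yields a unit vector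
almost `ℓ₁`-orthogonal to it. Iterating with summable errors gives an operator `T` from `ℓ₁`, almost
isometric and almost `ℓ₁`-orthogonal to a finite set (`IsOctahedral.exists_lpOne_operator`). If `Y ⧸
X` contains no copy of `ℓ₁`, the quotient map composed with `T` is not bounded below, so some
normalized `T c` lies close to `X`, and a nearby unit vector of `X` is the witness.

(c) ⇒ (d) holds because `ℓ₁` is infinite-dimensional; (d) ⇒ (a) takes `X = Y`.

(a) ⇒ (b): the local almost isometries carry a witness from `Y` into `X`. (b) ⇒ (a): a
Löwenheim–Skolem closing-off argument puts each finite set inside a separable ai-ideal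
(`exists_separable_isAIIdeal`). -/

/-- Almost additivity of the norm on two unit vectors extends to their nonnegative multiples. -/
theorem norm_smul_sub_smul_ge {a y : Y} (ha : ‖a‖ = 1) (hy : ‖y‖ = 1) {ε : ℝ} (hε : 0 ≤ ε)
    (h : 2 - ε ≤ ‖a - y‖) {s t : ℝ} (hs : 0 ≤ s) (ht : 0 ≤ t) :
    (1 - ε) * (s + t) ≤ ‖s • a - t • y‖ := by
  -- Scale `a - y` by the larger coefficient and remove the excess; the loss is `ε` times that
  -- coefficient.
  rcases le_total t s with hts | hst
  · have h1 : s • (a - y) = (s • a - t • y) - (s - t) • y := by module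
    have h2 := norm_sub_le (s • a - t • y) ((s - t) • y)
    rw [← h1, norm_smul, norm_smul, hy, Real.norm_of_nonneg hs,
      Real.norm_of_nonneg (sub_nonneg.2 hts)] at h2
    nlinarith [mul_le_mul_of_nonneg_left h hs, mul_nonneg hε ht]
  · have h1 : t • (a - y) = (s • a - t • y) + (t - s) • a := by module
    have h2 := norm_add_le (s • a - t • y) ((t - s) • a)
    rw [← h1, norm_smul, norm_smul, ha, Real.norm_of_nonneg ht,
      Real.norm_of_nonneg (sub_nonneg.2 hst)] at h2
    nlinarith [mul_le_mul_of_nonneg_left h ht, mul_nonneg hε hs]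

theorem norm_sub_inv_norm_smul {b : Y} (hb : 0 < ‖b‖) : ‖b - ‖b‖⁻¹ • b‖ = |‖b‖ - 1| := by
  have h : b - ‖b‖⁻¹ • b = (1 - ‖b‖⁻¹) • b := by module
  rw [h, norm_smul, Real.norm_eq_abs]
  conv_lhs => rw [← abs_of_pos hb, ← abs_mul, abs_of_pos hb, sub_mul, one_mul,
    inv_mul_cancel₀ hb.ne']

/-- In an octahedral space, every finite-dimensional subspace has an almost `ℓ₁`-orthogonal unit
vector. -/
theorem IsOctahedral.exists_almost_orthogonal (hY : IsOctahedral Y) (F : Submodule ℝ Y)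
    [FiniteDimensional ℝ F] {ε : ℝ} (hε : 0 < ε) :
    ∃ y : Y, ‖y‖ = 1 ∧ ∀ f ∈ F, ∀ t : ℝ, (1 - ε) * (‖f‖ + |t|) ≤ ‖f + t • y‖ := by
  classical
  have hc : IsCompact (Subtype.val '' Metric.sphere (0 : F) 1) :=
    (isCompact_sphere (0 : F) 1).image continuous_subtype_val
  obtain ⟨N, hNs, hNfin, hN⟩ := hc.finite_cover_balls (half_pos hε)
  obtain ⟨y, hy, hyN⟩ := hY (ε / 2) (half_pos hε) hNfin.toFinset (by
    intro a ha
    obtain ⟨b, hb, rfl⟩ := hNs (hNfin.mem_toFinset.1 ha)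
    simpa using hb)
  have hunit : ∀ a ∈ F, ‖a‖ = 1 → 2 - ε ≤ ‖a - y‖ := by
    intro a haF ha
    have : a ∈ ⋃ x ∈ N, Metric.ball x (ε / 2) := hN ⟨⟨a, haF⟩, by simpa using ha, rfl⟩
    simp only [Set.mem_iUnion, Metric.mem_ball, dist_eq_norm] at this
    obtain ⟨b, hbN, hab⟩ := this
    have h1 := hyN b (hNfin.mem_toFinset.2 hbN)
    have h2 := norm_sub_le (a - y) (a - b)
    rw [show a - y - (a - b) = b - y by abel] at h2
    linarith
  have hpos : ∀ f ∈ F, ∀ t : ℝ, 0 ≤ t → (1 - ε) * (‖f‖ + t) ≤ ‖f - t • y‖ := by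
    intro f hf t ht
    by_cases h0 : f = 0
    · subst h0
      rw [zero_sub, norm_neg, norm_smul, hy, Real.norm_of_nonneg ht, norm_zero]
      nlinarith [mul_nonneg hε.le ht]
    · have hf0 : ‖f‖ ≠ 0 := norm_ne_zero_iff.2 h0
      have ha : ‖‖f‖⁻¹ • f‖ = 1 := by
        rw [norm_smul, norm_inv, norm_norm, inv_mul_cancel₀ hf0]
      have := norm_smul_sub_smul_ge ha hy hε.le (hunit _ (F.smul_mem _ hf) ha) (norm_nonneg f) ht
      rwa [smul_inv_smul₀ hf0] at this
  refine ⟨y, hy, fun f hf t => ?_⟩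
  rcases le_total 0 t with ht | ht
  · have := hpos (-f) (F.neg_mem hf) t ht
    rw [norm_neg, show -f - t • y = -(f + t • y) by abel, norm_neg] at this
    rwa [abs_of_nonneg ht]
  · have := hpos f hf (-t) (neg_nonneg.2 ht)
    rw [neg_smul, sub_neg_eq_add] at this
    rwa [abs_of_nonpos ht]

/-- In an octahedral space, every finite set can be followed by a sequence which is almost
isometrically the basis of `ℓ₁`, and almost `ℓ₁`-orthogonal to the finite set. -/
theorem IsOctahedral.exists_seq (hY : IsOctahedral Y) (A : Finset Y) {ε : ℝ} (hε : 0 < ε) :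
    ∃ y : ℕ → Y, (∀ n, ‖y n‖ = 1) ∧ ∀ a ∈ A, ∀ (n : ℕ) (c : ℕ → ℝ),
      (1 - ε) * (‖a‖ + ∑ i ∈ Finset.range n, |c i|) ≤ ‖a + ∑ i ∈ Finset.range n, c i • y i‖ := by
  classical
  -- The errors `ε / 2 ^ (n + 1)` add up to less than `ε`.
  have key : ∀ (n : ℕ) (F : Finset Y), ∃ y : Y, ‖y‖ = 1 ∧ ∀ f ∈ Submodule.span ℝ (F : Set Y),
      ∀ t : ℝ, (1 - ε * (1 / 2) ^ (n + 1)) * (‖f‖ + |t|) ≤ ‖f + t • y‖ := fun n F =>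
    hY.exists_almost_orthogonal _ (by positivity)
  choose g hg1 hg using key
  let F : ℕ → Finset Y := fun n => Nat.rec A (fun k S => insert (g k S) S) n
  have hF : ∀ n, F (n + 1) = insert (g n (F n)) (F n) := fun n => rfl
  have hmono : Monotone F := monotone_nat_of_le_succ fun n => by
    rw [hF]; exact Finset.subset_insert _ _
  have hsum : ∀ a ∈ A, ∀ (n : ℕ) (c : ℕ → ℝ), a + ∑ i ∈ Finset.range n, c i • g i (F i) ∈
      Submodule.span ℝ (SetLike.coe (F n)) := by
    intro a ha n c
    refine add_mem (Submodule.subset_span (hmono (Nat.zero_le n) ha)) (sum_mem fun i hi => ?_)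
    refine Submodule.smul_mem _ _ (Submodule.subset_span ?_)
    have h1 : g i (F i) ∈ F (i + 1) := by rw [hF]; exact Finset.mem_insert_self _ _
    exact hmono (Nat.succ_le_of_lt (Finset.mem_range.1 hi)) h1
  have hbound : ∀ a ∈ A, ∀ (n : ℕ) (c : ℕ → ℝ),
      (1 - ε * (1 - (1 / 2) ^ n)) * (‖a‖ + ∑ i ∈ Finset.range n, |c i|) ≤
        ‖a + ∑ i ∈ Finset.range n, c i • g i (F i)‖ := by
    intro a ha n c
    induction n with
    | zero => simp
    | succ n ih =>
      have h := hg n (F n) _ (hsum a ha n c) (c n)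
      rw [Finset.sum_range_succ, Finset.sum_range_succ, ← add_assoc, ← add_assoc]
      refine le_trans ?_ h
      set S := ‖a‖ + ∑ i ∈ Finset.range n, |c i|
      set N := ‖a + ∑ i ∈ Finset.range n, c i • g i (F i)‖
      have hN : N ≤ S := by
        refine (norm_add_le _ _).trans (add_le_add le_rfl ((norm_sum_le _ _).trans ?_))
        refine Finset.sum_le_sum fun i _ => ?_
        rw [norm_smul, hg1, mul_one, Real.norm_eq_abs]
      have hp : (0 : ℝ) < (1 / 2) ^ n := by positivity
      have hp1 : ((1 : ℝ) / 2) ^ n ≤ 1 := pow_le_one₀ (by norm_num) (by norm_num)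
      set p := ((1 : ℝ) / 2) ^ n
      rw [pow_succ]
      change _ ≤ (1 - ε * (p * (1 / 2))) * (N + |c n|)
      have h1 : ε * (p * (1 / 2)) * N ≤ ε * (p * (1 / 2)) * S :=
        mul_le_mul_of_nonneg_left hN (by positivity)
      have h2 : 0 ≤ ε * (1 - p) * |c n| :=
        mul_nonneg (mul_nonneg hε.le (sub_nonneg.2 hp1)) (abs_nonneg _)
      nlinarith
  refine ⟨fun n => g n (F n), fun n => hg1 _ _, fun a ha n c => le_trans ?_ (hbound a ha n c)⟩
  have hp : (0 : ℝ) < (1 / 2) ^ n := by positivity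
  have : 0 ≤ ‖a‖ + ∑ i ∈ Finset.range n, |c i| :=
    add_nonneg (norm_nonneg _) (Finset.sum_nonneg fun _ _ => abs_nonneg _)
  refine mul_le_mul_of_nonneg_right ?_ this
  nlinarith [mul_pos hε hp]

/-! ### Operators from `ℓ₁` and copies of `ℓ₁`. -/

theorem lp_one_summable_abs (c : lp (fun _ : ℕ => ℝ) 1) : Summable fun i => |c i| := by
  simpa using c.2.summable (by simp)

theorem lp_one_norm_eq_tsum (c : lp (fun _ : ℕ => ℝ) 1) : ‖c‖ = ∑' i, |c i| := by
  rw [lp.norm_eq_tsum_rpow (by simp)]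
  simp

/-- The operator from `ℓ₁` which maps the unit vector basis to a given sequence of unit vectors. -/
noncomputable def lpOneLift [CompleteSpace Y] (y : ℕ → Y) (hy : ∀ n, ‖y n‖ = 1) :
    lp (fun _ : ℕ => ℝ) 1 →L[ℝ] Y :=
  have hsum : ∀ c : lp (fun _ : ℕ => ℝ) 1, Summable fun i => c i • y i := fun c =>
    Summable.of_norm (by simpa [norm_smul, hy] using lp_one_summable_abs c)
  LinearMap.mkContinuous
    { toFun := fun c => ∑' i, c i • y i
      map_add' := fun c d => by
        rw [← (hsum c).tsum_add (hsum d)]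
        simp [add_smul]
      map_smul' := fun r c => by
        rw [RingHom.id_apply, ← (hsum c).tsum_const_smul]
        simp [mul_smul] }
    1 (fun c => by
      rw [one_mul, lp_one_norm_eq_tsum]
      refine (norm_tsum_le_tsum_norm ?_).trans_eq ?_
      · simpa [norm_smul, hy] using lp_one_summable_abs c
      · simp [norm_smul, hy])

theorem lpOneLift_hasSum [CompleteSpace Y] (y : ℕ → Y) (hy : ∀ n, ‖y n‖ = 1)
    (c : lp (fun _ : ℕ => ℝ) 1) : HasSum (fun i => c i • y i) (lpOneLift y hy c) :=
  (Summable.of_norm (by simpa [norm_smul, hy] using lp_one_summable_abs c)).hasSum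

theorem norm_lpOneLift_le [CompleteSpace Y] (y : ℕ → Y) (hy : ∀ n, ‖y n‖ = 1)
    (c : lp (fun _ : ℕ => ℝ) 1) : ‖lpOneLift y hy c‖ ≤ ‖c‖ := by
  rw [← (lpOneLift_hasSum y hy c).tsum_eq, lp_one_norm_eq_tsum]
  refine (norm_tsum_le_tsum_norm ?_).trans_eq ?_
  · simpa [norm_smul, hy] using lp_one_summable_abs c
  · simp [norm_smul, hy]

/-- An octahedral Banach space contains almost isometric copies of `ℓ₁` which are almost
`ℓ₁`-orthogonal to a given finite set. -/
theorem IsOctahedral.exists_lpOne_operator [CompleteSpace Y] (hY : IsOctahedral Y) (A : Finset Y)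
    {ε : ℝ} (hε : 0 < ε) :
    ∃ T : lp (fun _ : ℕ => ℝ) 1 →L[ℝ] Y, (∀ c, ‖T c‖ ≤ ‖c‖) ∧
      ∀ a ∈ A, ∀ c, (1 - ε) * (‖a‖ + ‖c‖) ≤ ‖a + T c‖ := by
  obtain ⟨y, hy, h⟩ := hY.exists_seq A hε
  refine ⟨lpOneLift y hy, norm_lpOneLift_le y hy, fun a ha c => ?_⟩
  have h1 := ((lpOneLift_hasSum y hy c).tendsto_sum_nat.const_add a).norm
  have h2 := (((lp_one_summable_abs c).hasSum.tendsto_sum_nat).const_add ‖a‖).const_mul (1 - ε)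
  rw [← lp_one_norm_eq_tsum] at h2
  exact le_of_tendsto_of_tendsto' h2 h1 fun n => h a ha n c

/-- An operator from `ℓ₁` which is bounded below yields a copy of `ℓ₁`. -/
theorem containsCopyOfL1_of_bounded_below {Z : Type*} [SeminormedAddCommGroup Z] [NormedSpace ℝ Z]
    (T : lp (fun _ : ℕ => ℝ) 1 →L[ℝ] Z) {δ : ℝ} (hδ : 0 < δ) (h : ∀ c, δ * ‖c‖ ≤ ‖T c‖) :
    ContainsCopyOfL1 Z := by
  have hinj : Function.Injective T.toLinearMap := by
    refine (injective_iff_map_eq_zero _).2 fun c hc => ?_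
    have h1 := h c
    rw [show T c = 0 from hc, norm_zero] at h1
    exact norm_le_zero_iff.1 (nonpos_of_mul_nonpos_right h1 hδ)
  refine ⟨T.toLinearMap.range,
    ⟨(LinearEquiv.ofInjective T.toLinearMap hinj).toContinuousLinearEquivOfBounds
    ‖T‖ δ⁻¹ (fun c => T.le_opNorm c) fun w => ?_⟩⟩
  obtain ⟨c, rfl⟩ := (LinearEquiv.ofInjective T.toLinearMap hinj).surjective w
  rw [LinearEquiv.symm_apply_apply, ← div_eq_inv_mul, le_div_iff₀' hδ]
  exact h c

/-! ### Inheritance by subspaces. -/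

/-- Octahedrality passes to the subspaces whose quotient contains no copy of `ℓ₁`. -/
theorem IsOctahedral.of_not_containsCopyOfL1_quotient [CompleteSpace Y] (hY : IsOctahedral Y)
    (X : Submodule ℝ Y) (hX : ¬ ContainsCopyOfL1 (Y ⧸ X)) : IsOctahedral X := by
  classical
  intro ε hε A hA
  obtain ⟨δ, hδ, hδ1, hδε⟩ : ∃ δ : ℝ, 0 < δ ∧ δ ≤ 1 / 4 ∧ 5 * δ ≤ ε :=
    ⟨min (1 / 4) (ε / 5), by positivity, min_le_left _ _, by
      linarith [min_le_right (1 / 4) (ε / 5)]⟩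
  -- Including `0` makes `T` itself bounded below.
  obtain ⟨T, hT, hTA⟩ := hY.exists_lpOne_operator (insert 0 (A.image Subtype.val)) hδ
  obtain ⟨c, hc⟩ : ∃ c, ‖X.mkQ (T c)‖ < δ * ‖c‖ := by
    by_contra! hcon
    let Q : Y →L[ℝ] Y ⧸ X := X.mkQ.mkContinuous 1 fun y => by
      simpa using Submodule.Quotient.norm_mk_le X y
    exact hX (containsCopyOfL1_of_bounded_below (Q.comp T) hδ hcon)
  have hc0 : 0 < ‖c‖ := pos_of_mul_pos_right ((norm_nonneg _).trans_lt hc) hδ.le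
  obtain ⟨m, hm, hmlt⟩ := Submodule.Quotient.norm_mk_lt (X.mkQ (T c)) (sub_pos.2 hc)
  rw [add_sub_cancel] at hmlt
  have hmX : T c - m ∈ X := by
    rw [← Submodule.Quotient.mk_eq_zero, Submodule.Quotient.mk_sub, hm]
    exact sub_self _
  set b : Y := ‖c‖⁻¹ • (T c - m) with hb
  have hbX : b ∈ X := X.smul_mem _ hmX
  have hnear : ‖T (‖c‖⁻¹ • c) - b‖ ≤ δ := by
    rw [map_smul, hb, ← smul_sub, sub_sub_cancel, norm_smul, norm_inv, norm_norm,
      ← div_eq_inv_mul, div_le_iff₀ hc0]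
    exact hmlt.le
  have hd : ‖‖c‖⁻¹ • c‖ = 1 := by
    rw [norm_smul, norm_inv, norm_norm, inv_mul_cancel₀ hc0.ne']
  set d := ‖c‖⁻¹ • c
  have hTd : ‖T d‖ ≤ 1 := hd ▸ hT d
  have hTd' : 1 - δ ≤ ‖T d‖ := by
    have := hTA 0 (Finset.mem_insert_self _ _) d
    simpa [hd] using this
  have hb1 : ‖b‖ ≤ 1 + δ := by
    have := norm_sub_le (T d) (T d - b)
    rw [sub_sub_cancel] at this
    linarith
  have hb2 : 1 - 2 * δ ≤ ‖b‖ := by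
    have := norm_add_le (T d - b) b
    rw [sub_add_cancel] at this
    linarith
  have hb0 : 0 < ‖b‖ := by linarith
  have hxb : ‖b - ‖b‖⁻¹ • b‖ ≤ 2 * δ := by
    rw [norm_sub_inv_norm_smul hb0, abs_le]
    constructor <;> linarith
  -- The sign turns the estimate for `a + T d` into one for a difference. The losses are `2δ` from
  -- `hTA`, `δ` from `hnear` and `2δ` from `hxb`.
  refine ⟨⟨-(‖b‖⁻¹ • b), X.neg_mem (X.smul_mem _ hbX)⟩, ?_, fun a ha => ?_⟩
  · rw [Submodule.coe_norm, norm_neg, norm_smul, norm_inv, norm_norm, inv_mul_cancel₀ hb0.ne']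
  · have h1 := hTA a (Finset.mem_insert_of_mem (Finset.mem_image_of_mem _ ha)) d
    rw [hd, ← Submodule.coe_norm, hA a ha] at h1
    have h2 : ‖(a : Y) + T d‖ ≤ ‖(a : Y) + ‖b‖⁻¹ • b‖ + ‖T d - b‖ + ‖b - ‖b‖⁻¹ • b‖ := by
      refine le_trans (le_of_eq ?_) (norm_add₃_le (a := (a : Y) + ‖b‖⁻¹ • b))
      congr 1
      abel
    rw [Submodule.coe_norm, Submodule.coe_sub, sub_neg_eq_add]
    linarith

theorem not_finiteDimensional_lp_one : ¬ FiniteDimensional ℝ (lp (fun _ : ℕ => ℝ) 1) := by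
  intro h
  let φ : lp (fun _ : ℕ => ℝ) 1 →ₗ[ℝ] (ℕ → ℝ) :=
    { toFun := fun c => c, map_add' := fun _ _ => rfl, map_smul' := fun _ _ => rfl }
  have hli : LinearIndependent ℝ fun n : ℕ => (lp.single 1 n 1 : lp (fun _ : ℕ => ℝ) 1) := by
    refine LinearIndependent.of_comp φ ?_
    convert Pi.linearIndependent_single_one ℕ ℝ using 1
    funext n
    exact lp.coeFn_single 1 n 1
  have := hli.finite
  exact not_finite ℕ

theorem not_containsCopyOfL1_of_finiteDimensional {Z : Type*} [SeminormedAddCommGroup Z]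
    [NormedSpace ℝ Z] [FiniteDimensional ℝ Z] : ¬ ContainsCopyOfL1 Z := by
  rintro ⟨W, ⟨e⟩⟩
  exact not_finiteDimensional_lp_one (LinearEquiv.finiteDimensional e.symm.toLinearEquiv)

theorem IsOctahedral.of_linearIsometryEquiv {Z : Type*} [NormedAddCommGroup Z] [NormedSpace ℝ Z]
    (e : Z ≃ₗᵢ[ℝ] Y) (hZ : IsOctahedral Z) : IsOctahedral Y := by
  classical
  intro ε hε A hA
  obtain ⟨z, hz, h⟩ := hZ ε hε (A.image e.symm) (by simpa using hA)
  refine ⟨e z, by simpa using hz, fun a ha => ?_⟩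
  have := h _ (Finset.mem_image_of_mem _ ha)
  rwa [← e.norm_map, map_sub, e.apply_symm_apply] at this

/-- Push a witness `y` into `X` by an almost isometry on the span of `A` and `y`, which fixes `A`,
and normalize the image. -/
theorem IsOctahedral.of_isAIIdeal (hY : IsOctahedral Y) {X : Submodule ℝ Y} (hX : IsAIIdeal X) :
    IsOctahedral X := by
  classical
  intro ε hε A hA
  obtain ⟨δ, hδ, hδ1, hδε⟩ : ∃ δ : ℝ, 0 < δ ∧ δ ≤ 1 / 4 ∧ 4 * δ ≤ ε :=
    ⟨min (1 / 4) (ε / 4), by positivity, min_le_left _ _, by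
      linarith [min_le_right (1 / 4) (ε / 4)]⟩
  obtain ⟨y, hy, hyA⟩ := hY δ hδ (A.image Subtype.val) (by
    intro a ha
    obtain ⟨b, hb, rfl⟩ := Finset.mem_image.1 ha
    exact hA b hb)
  let E := Submodule.span ℝ ((insert y (A.image Subtype.val) : Finset Y) : Set Y)
  obtain ⟨T, hTX, hT⟩ := hX δ hδ E inferInstance
  have hyE : y ∈ E := Submodule.subset_span (Finset.mem_insert_self _ _)
  set w : X := T ⟨y, hyE⟩ with hw
  have hw1 : 1 - δ ≤ ‖w‖ ∧ ‖w‖ ≤ 1 + δ := by simpa [hy] using hT ⟨y, hyE⟩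
  have hw0 : 0 < ‖w‖ := by linarith
  have hxw : ‖w - ‖w‖⁻¹ • w‖ ≤ δ := by
    rw [norm_sub_inv_norm_smul hw0, abs_le]
    constructor <;> linarith
  refine ⟨‖w‖⁻¹ • w, ?_, fun a ha => ?_⟩
  · rw [norm_smul, norm_inv, norm_norm, inv_mul_cancel₀ hw0.ne']
  · have haE : (a : Y) ∈ E :=
      Submodule.subset_span (Finset.mem_insert_of_mem (Finset.mem_image_of_mem _ ha))
    have hTa : T ⟨a, haE⟩ = a := Subtype.ext (hTX ⟨a, haE⟩ a.2)
    have h1 := (hT (⟨a, haE⟩ - ⟨y, hyE⟩)).1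
    rw [map_sub, hTa, ← hw] at h1
    have h2 : 2 - δ ≤ ‖(⟨a, haE⟩ - ⟨y, hyE⟩ : E)‖ := hyA a (Finset.mem_image_of_mem _ ha)
    have h3 : ‖a - w‖ ≤ ‖a - ‖w‖⁻¹ • w‖ + ‖w - ‖w‖⁻¹ • w‖ := by
      refine le_trans (le_of_eq ?_) (norm_sub_le _ _)
      congr 1
      abel
    nlinarith

end Octahedral

/-! ### Separable ai-ideals by closing off. -/

section Saturation

variable {Y : Type*} [NormedAddCommGroup Y] [NormedSpace ℝ Y]

/-- The linear combinations of two finite families, as an operator on the coefficient space. -/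
noncomputable def pairCombination {n m : ℕ} (d : Fin n → Y) (x : Fin m → Y) :
    (Fin n → ℝ) × (Fin m → ℝ) →ₗ[ℝ] Y :=
  (Fintype.linearCombination ℝ d).coprod (Fintype.linearCombination ℝ x)

theorem pairCombination_apply {n m : ℕ} (d : Fin n → Y) (x : Fin m → Y)
    (c : (Fin n → ℝ) × (Fin m → ℝ)) :
    pairCombination d x c = ∑ i, c.1 i • d i + ∑ j, c.2 j • x j := rfl

/-- `X` realizes approximately the norm of all finite families of vectors of `Y` over finite
families in `W`. -/
def RealizesOver (W X : Submodule ℝ Y) : Prop :=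
  ∀ (n m : ℕ) (d : Fin n → Y) (e : Fin m → Y), (∀ i, d i ∈ W) → ∀ δ : ℝ, 0 < δ →
    ∃ x : Fin m → Y, (∀ j, x j ∈ X) ∧
      ∀ c, |‖pairCombination d x c‖ - ‖pairCombination d e c‖| ≤ δ * ‖c‖

theorem abs_norm_pairCombination_sub_le {n m : ℕ} (d d' : Fin n → Y) (x : Fin m → Y)
    (c : (Fin n → ℝ) × (Fin m → ℝ)) :
    |‖pairCombination d x c‖ - ‖pairCombination d' x c‖| ≤ (n * dist d d') * ‖c‖ := by
  refine (abs_norm_sub_norm_le _ _).trans ?_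
  rw [pairCombination_apply, pairCombination_apply, add_sub_add_right_eq_sub,
    ← Finset.sum_sub_distrib]
  refine (norm_sum_le _ _).trans ?_
  have : ∀ i ∈ Finset.univ, ‖c.1 i • d i - c.1 i • d' i‖ ≤ ‖c‖ * dist d d' := by
    intro i _
    rw [← smul_sub, norm_smul, ← dist_eq_norm]
    exact mul_le_mul ((norm_le_pi_norm c.1 i).trans (norm_fst_le c)) (dist_le_pi_dist d d' i)
      dist_nonneg (norm_nonneg _)
  refine (Finset.sum_le_sum this).trans_eq ?_
  simp
  ring

/-- The norm function of a finite pair of families, on the unit ball of the coefficient space. -/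
noncomputable def normFunction {n m : ℕ} (d : Fin n → Y) (x : Fin m → Y) :
    C(Metric.closedBall (0 : (Fin n → ℝ) × (Fin m → ℝ)) 1, ℝ) :=
  ⟨fun c => ‖pairCombination d x c‖,
    ((pairCombination d x).continuous_of_finiteDimensional.comp continuous_subtype_val).norm⟩

/-- By homogeneity, uniform closeness on the unit ball suffices. -/
theorem abs_norm_pairCombination_sub_le_of_dist {n m : ℕ} {d d' : Fin n → Y} {x x' : Fin m → Y}
    {δ : ℝ} (h : dist (normFunction d x) (normFunction d' x') ≤ δ)
    (c : (Fin n → ℝ) × (Fin m → ℝ)) :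
    |‖pairCombination d x c‖ - ‖pairCombination d' x' c‖| ≤ δ * ‖c‖ := by
  by_cases hc : c = 0
  · simp [hc]
  have hc0 : 0 < ‖c‖ := norm_pos_iff.2 hc
  have hmem : ‖c‖⁻¹ • c ∈ Metric.closedBall (0 : (Fin n → ℝ) × (Fin m → ℝ)) 1 := by
    rw [mem_closedBall_zero_iff, norm_smul, norm_inv, norm_norm, inv_mul_cancel₀ hc0.ne']
  have h1 := (ContinuousMap.dist_apply_le_dist ⟨_, hmem⟩).trans h
  change dist ‖pairCombination d x (‖c‖⁻¹ • c)‖ ‖pairCombination d' x' (‖c‖⁻¹ • c)‖ ≤ δ at h1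
  rw [map_smul, map_smul, norm_smul, norm_smul, norm_inv, norm_norm, Real.dist_eq, ← mul_sub,
    abs_mul, abs_of_pos (inv_pos.2 hc0), ← div_eq_inv_mul, div_le_iff₀ hc0] at h1
  exact h1

/-- Second countability pulls back along `Φ`, so the dense set can be chosen in `α` itself. -/
theorem exists_countable_dense_image {α M : Type*} [PseudoMetricSpace M]
    [SecondCountableTopology M] (Φ : α → M) :
    ∃ C : Set α, C.Countable ∧ ∀ a, ∀ δ : ℝ, 0 < δ → ∃ b ∈ C, dist (Φ a) (Φ b) < δ := by
  let _ : TopologicalSpace α := TopologicalSpace.induced Φ inferInstance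
  have hΦ : Topology.IsInducing Φ := ⟨rfl⟩
  have := hΦ.secondCountableTopology
  obtain ⟨C, hC, hd⟩ := TopologicalSpace.exists_countable_dense α
  refine ⟨C, hC, fun a δ hδ => ?_⟩
  obtain ⟨b, hb, hbC⟩ := hd.inter_open_nonempty (Φ ⁻¹' Metric.ball (Φ a) δ)
    (Metric.isOpen_ball.preimage hΦ.continuous) ⟨a, by simpa using hδ⟩
  exact ⟨b, hbC, by simpa [dist_comm] using hb⟩

/-- Every separable subspace is contained in a separable one which realizes norms over it. -/
theorem exists_separable_realizesOver (W : Submodule ℝ Y)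
    (hW : TopologicalSpace.IsSeparable (W : Set Y)) :
    ∃ X : Submodule ℝ Y, W ≤ X ∧ TopologicalSpace.IsSeparable (X : Set Y) ∧ RealizesOver W X := by
  have := hW.secondCountableTopology
  -- Pairs in `W ^ n × C(ball, ℝ)` form a second countable space, so countably many families `x`
  -- approximate all norm patterns over `W`.
  have hC := fun n m : ℕ => exists_countable_dense_image
    (fun p : (Fin n → W) × (Fin m → Y) => (p.1, normFunction (fun i => (p.1 i : Y)) p.2))
  choose C hCc hC using hC
  let S : Set Y := W ∪ ⋃ (n : ℕ) (m : ℕ), ⋃ p ∈ C n m, Set.range p.2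
  have hS : TopologicalSpace.IsSeparable S := by
    refine hW.union (.iUnion fun n => .iUnion fun m => Set.Countable.isSeparable ?_)
    exact (hCc n m).biUnion fun p _ => Set.countable_range _
  refine ⟨Submodule.span ℝ S, fun w hw => Submodule.subset_span (Or.inl hw), hS.span, ?_⟩
  intro n m d e hd δ hδ
  obtain ⟨b, hb, hdist⟩ := hC n m (fun i => ⟨d i, hd i⟩, e) (δ / (n + 1)) (by positivity)
  rw [Prod.dist_eq, max_lt_iff] at hdist
  obtain ⟨h1, h2⟩ := hdist
  refine ⟨b.2, fun j => Submodule.subset_span (Or.inr ?_), fun c => ?_⟩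
  · simp only [Set.mem_iUnion]
    exact ⟨n, m, b, hb, j, rfl⟩
  · have h3 := abs_norm_pairCombination_sub_le d (fun i => (b.1 i : Y)) b.2 c
    have h4 := abs_norm_pairCombination_sub_le_of_dist h2.le c
    have h5 : dist d (fun i => (b.1 i : Y)) ≤ δ / (n + 1) := by
      refine (dist_pi_le_iff (by positivity)).2 fun i => ?_
      exact (dist_le_pi_dist (fun i => (⟨d i, hd i⟩ : W)) b.1 i).trans h1.le
    have h6 : (n * dist d (fun i => (b.1 i : Y)) + δ / (n + 1)) ≤ δ := by
      calc n * dist d (fun i => (b.1 i : Y)) + δ / (n + 1) ≤ n * (δ / (n + 1)) + δ / (n + 1) := by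
            gcongr
        _ = δ := by field_simp
    rw [abs_sub_comm] at h4
    refine (abs_sub_le _ _ _).trans ((add_le_add h3 h4).trans ?_)
    rw [← add_mul]
    exact mul_le_mul_of_nonneg_right h6 (norm_nonneg _)

/-- Every separable subspace is contained in a closed separable one which realizes norms over
itself. -/
theorem exists_separable_realizesOver_self (W : Submodule ℝ Y)
    (hW : TopologicalSpace.IsSeparable (W : Set Y)) :
    ∃ X : Submodule ℝ Y, W ≤ X ∧ IsClosed (X : Set Y) ∧
      TopologicalSpace.IsSeparable (X : Set Y) ∧ RealizesOver X X := by
  choose! G hG1 hG2 hG3 using exists_separable_realizesOver (Y := Y)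
  -- Each stage realizes norms over the previous one, so the closure of the union does so over
  -- itself.
  let V : ℕ → Submodule ℝ Y := fun k => G^[k] W
  have hV : ∀ k, V (k + 1) = G (V k) := fun k => Function.iterate_succ_apply' G k W
  have hVs : ∀ k, TopologicalSpace.IsSeparable (V k : Set Y) := by
    intro k
    induction k with
    | zero => exact hW
    | succ k ih => rw [hV]; exact hG2 _ ih
  have hmono : Monotone V := monotone_nat_of_le_succ fun k => by rw [hV]; exact hG1 _ (hVs k)
  have hcoe : ((⨆ k, V k : Submodule ℝ Y) : Set Y) = ⋃ k, (V k : Set Y) :=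
    Submodule.coe_iSup_of_directed V hmono.directed_le
  refine ⟨(⨆ k, V k).topologicalClosure, (le_iSup V 0).trans (Submodule.le_topologicalClosure _),
    Submodule.isClosed_topologicalClosure _, ?_, ?_⟩
  · rw [Submodule.topologicalClosure_coe, hcoe]
    exact (TopologicalSpace.IsSeparable.iUnion hVs).closure
  intro n m d e hd δ hδ
  -- Passing from `d` to `b` and back costs `n` shares each; realizing over `b` costs one.
  have happrox : ∀ i, ∃ b, (∃ k, b ∈ V k) ∧ dist (d i) b < δ / (2 * n + 1) := by
    intro i
    have h1 : d i ∈ closure ((⨆ k, V k : Submodule ℝ Y) : Set Y) := hd i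
    obtain ⟨b, hb, hdist⟩ := Metric.mem_closure_iff.1 h1 (δ / (2 * n + 1)) (by positivity)
    rw [hcoe, Set.mem_iUnion] at hb
    exact ⟨b, hb, hdist⟩
  choose b hb hdist using happrox
  choose k hk using hb
  have hbK : ∀ i, b i ∈ V (Finset.univ.sup k) := fun i =>
    hmono (Finset.le_sup (Finset.mem_univ i)) (hk i)
  obtain ⟨x, hx, hxc⟩ := hG3 _ (hVs (Finset.univ.sup k)) n m b e hbK (δ / (2 * n + 1))
    (by positivity)
  rw [← hV] at hx
  refine ⟨x, fun j => Submodule.le_topologicalClosure _ (le_iSup V _ (hx j)), fun c => ?_⟩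
  have hdb : dist d b ≤ δ / (2 * n + 1) :=
    (dist_pi_le_iff (by positivity)).2 fun i => (hdist i).le
  have h1 := abs_norm_pairCombination_sub_le d b x c
  have h2 := abs_norm_pairCombination_sub_le b d e c
  rw [dist_comm] at h2
  have h3 : n * dist d b + δ / (2 * n + 1) + n * dist d b ≤ δ := by
    calc n * dist d b + δ / (2 * n + 1) + n * dist d b
        ≤ n * (δ / (2 * n + 1)) + δ / (2 * n + 1) + n * (δ / (2 * n + 1)) := by gcongr
      _ = δ := by field_simp; ring
  refine (abs_sub_le _ _ _).trans ((add_le_add ((abs_sub_le _ _ _).trans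
    (add_le_add h1 (hxc c))) h2).trans ?_)
  rw [← add_mul, ← add_mul]
  exact mul_le_mul_of_nonneg_right h3 (norm_nonneg _)

/-- Split `E` as `E ∩ X` plus a complement; keep the first summand and send a basis of the second to
vectors of `X` realizing its norms over a basis of the first. -/
theorem RealizesOver.isAIIdeal {X : Submodule ℝ Y} (h : RealizesOver X X) : IsAIIdeal X := by
  intro ε hε E hE
  let B : Submodule ℝ E := X.comap E.subtype
  obtain ⟨C, hBC⟩ := B.exists_isCompl
  let b := Module.finBasis ℝ B
  let e := Module.finBasis ℝ C
  let coord : E →ₗ[ℝ] (Fin (Module.finrank ℝ B) → ℝ) × (Fin (Module.finrank ℝ C) → ℝ) :=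
    (b.equivFun.toLinearMap ∘ₗ B.projectionOnto C hBC).prod
      (e.equivFun.toLinearMap ∘ₗ C.projectionOnto B hBC.symm)
  let K := ‖LinearMap.toContinuousLinearMap coord‖
  have hK : ∀ v, ‖coord v‖ ≤ K * ‖v‖ := (LinearMap.toContinuousLinearMap coord).le_opNorm
  have hK0 : 0 ≤ K := norm_nonneg (LinearMap.toContinuousLinearMap coord)
  -- `K` converts coefficient norms into norms on `E`; the `+ 1` covers `K = 0`.
  obtain ⟨x, hx, hxc⟩ := h _ _ (fun i => ((b i : E) : Y)) (fun j => ((e j : E) : Y))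
    (fun i => (b i).2) (ε / (K + 1)) (by positivity)
  let j : B →ₗ[ℝ] X := (E.subtype ∘ₗ B.subtype).codRestrict X fun v => v.2
  let T : E →ₗ[ℝ] X := LinearMap.ofIsCompl hBC j (e.constr ℝ fun i => ⟨x i, hx i⟩)
  have hid : ∀ v : E, pairCombination (fun i => ((b i : E) : Y)) (fun j => ((e j : E) : Y))
      (coord v) = v := by
    intro v
    have h1 := congrArg (fun w : B => ((w : E) : Y)) (b.sum_equivFun (B.projectionOnto C hBC v))
    have h2 := congrArg (fun w : C => ((w : E) : Y))
      (e.sum_equivFun (C.projectionOnto B hBC.symm v))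
    have h3 := congrArg (fun w : E => (w : Y))
      (Submodule.projection_add_projection_eq_self hBC v)
    simp only [Submodule.coe_sum, Submodule.coe_smul, Submodule.coe_add,
      Submodule.coe_projectionOnto_apply] at h1 h2 h3
    rw [pairCombination_apply, ← h3, ← h1, ← h2]
    rfl
  have hTv : ∀ v : E, pairCombination (fun i => ((b i : E) : Y)) x (coord v) = T v := by
    intro v
    have h1 := congrArg (fun w : B => ((w : E) : Y)) (b.sum_equivFun (B.projectionOnto C hBC v))
    simp only [Submodule.coe_sum, Submodule.coe_smul] at h1
    have h2 : T v = j (B.projectionOnto C hBC v) +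
        (e.constr ℝ fun i => (⟨x i, hx i⟩ : X)) (C.projectionOnto B hBC.symm v) := by
      simp only [T, LinearMap.ofIsCompl_eq_add]
      rfl
    rw [pairCombination_apply, h2, Module.Basis.constr_apply_fintype]
    simp only [Submodule.coe_sum, Submodule.coe_smul, Submodule.coe_add]
    change _ = ((B.projectionOnto C hBC v : E) : Y) + _
    rw [← h1]
    rfl
  refine ⟨T, fun v hv => ?_, fun v => ?_⟩
  · exact congrArg Subtype.val (LinearMap.ofIsCompl_apply_left hBC (⟨v, hv⟩ : B))
  · have h1 := hxc (coord v)
    rw [hid, hTv] at h1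
    have h2 : ε / (K + 1) * ‖coord v‖ ≤ ε * ‖v‖ := by
      calc ε / (K + 1) * ‖coord v‖ ≤ ε / (K + 1) * ((K + 1) * ‖v‖) := by
            gcongr
            exact (hK v).trans (by gcongr; linarith)
        _ = ε * ‖v‖ := by field_simp
    have h3 := abs_le.1 (h1.trans h2)
    rw [← Submodule.coe_norm, ← Submodule.coe_norm] at h3
    constructor <;> linarith [h3.1, h3.2]

/-- Every finite set is contained in a closed separable ai-ideal. -/
theorem exists_separable_isAIIdeal (A : Finset Y) :
    ∃ X : Submodule ℝ Y, (A : Set Y) ⊆ X ∧ IsClosed (X : Set Y) ∧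
      TopologicalSpace.SeparableSpace X ∧ IsAIIdeal X := by
  obtain ⟨X, hAX, hX, hXs, hXX⟩ := exists_separable_realizesOver_self
    (Submodule.span ℝ (A : Set Y)) A.countable_toSet.isSeparable.span
  exact ⟨X, Submodule.subset_span.trans hAX, hX, hXs.separableSpace, hXX.isAIIdeal⟩

end Saturation

/-! ### The equivalence. -/

theorem mainTheorem5 {Y : Type*} [NormedAddCommGroup Y] [NormedSpace ℝ Y] [CompleteSpace Y] :
    List.TFAE [
      IsOctahedral Y,
      ∀ X : Submodule ℝ Y, IsClosed (X : Set Y) → TopologicalSpace.SeparableSpace X →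
        IsAIIdeal X → IsOctahedral X,
      ∀ X : Submodule ℝ Y, IsClosed (X : Set Y) → ¬ ContainsCopyOfL1 (Y ⧸ X) →
        IsOctahedral X,
      ∀ X : Submodule ℝ Y, IsClosed (X : Set Y) → FiniteDimensional ℝ (Y ⧸ X) →
        IsOctahedral X] := by
  tfae_have 1 → 2 := fun h X _ _ hX => h.of_isAIIdeal hX
  tfae_have 2 → 1 := by
    classical
    intro h ε hε A hA
    obtain ⟨X, hAX, hXc, hXs, hX⟩ := exists_separable_isAIIdeal A
    obtain ⟨x, hx, hxA⟩ := h X hXc hXs hX ε hε (A.subtype (· ∈ X)) fun a ha =>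
      hA a (Finset.mem_subtype.1 ha)
    exact ⟨x, hx, fun a ha => hxA ⟨a, hAX ha⟩ (Finset.mem_subtype.2 ha)⟩
  tfae_have 1 → 3 := fun h X _ hX => h.of_not_containsCopyOfL1_quotient X hX
  tfae_have 3 → 4 := fun h X hXc _ => h X hXc not_containsCopyOfL1_of_finiteDimensional
  tfae_have 4 → 1 := fun h =>
    (h ⊤ isClosed_univ inferInstance).of_linearIsometryEquiv (LinearIsometryEquiv.ofTop Y ⊤ rfl)
  tfae_finish
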